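/- Consider a wireless network whose transmitters form a homogeneous Poisson point process of density $\lambda>0$ in the plane. Each transmitter has a receiver at distance $d>0$, path loss has exponent $\alpha>2$, fading is independent Rayleigh, noise is neglected, and a transmission succeeds if the signal to interference ratio exceeds $\theta>0$; the rate is $R=\log_2(1+\theta)$. Each transmitter has a battery of finite capacity $B\ge 1$. In each slot a unit of energy arrives with probability $p\in(0,1]$, and a transmitter with access probability $q\in[0,1]$ transmits with probability $q$, using one unit of energy, if its battery is not empty. Its energy is thus a Markov chain on $\{0,\dots,B\}$ with transitions $0\to1$ with probability $p$, $i\to i+1$ with probability $p(1-q)$ for $1\le i<B$, $i\to i-1$ with probability $q(1-p)$ for $1\le i\le B$, and $i\to i$ otherwise. Let $r_B(q)$ be the stationary probability that the battery is not empty, $f_B(q)=q\,r_B(q)$ for $q\in[0,1]$, and $\lambda_{\max}=\bigl(d^2\theta^{2/\alpha}\kappa(\alpha)\bigr)^{-1}$ with $\kappa(\alpha)=\frac{2\pi^2}{\alpha\sin(2\pi/\alpha)}$. In the throughput game, a transmitter that uses $q$ while all others use $\tilde q$ gets the throughput $\mathsf{TH}(q,\tilde q)=f_B(q)\,P_{\mathrm{suc}}(\tilde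 q)\,R$, where $P_{\mathrm{suc}}(\tilde q)$ is the success probability at a typical receiver when the interferers use $\tilde q$ and their batteries are in steady state. A symmetric Nash equilibrium is a $q^*\in[0,1]$ with $\mathsf{TH}(q^*,q^*)=\max_{q\in[0,1]}\mathsf{TH}(q,q^*)$. The price of anarchy is the ratio of the maximum over $q\in[0,1]$ of the transmission capacity $C(q)=\lambda\,\mathsf{TH}(q,q)$ to the least value of $C$ at a symmetric Nash equilibrium. If the equation $f_B(y)=\lambda_{\max}/\lambda$ has no solution $y\in[0,1]$ (its solution exceeds $1$), then the price of anarchy is $1$. Otherwise, every $q^\star\in[0,1]$ with $f_B(q^\star)=\lambda_{\max}/\lambda$ maximizes $C$ over $[0,1]$, and the price of anarchy is $$\frac{\lambda f_B(q^\star)\exp\left(-\frac{\lambda f_B(q^\star)}{\lambda_{\max}}\right)}{\lambda p\exp\left(-\frac{\lambda p}{\lambda_{\max}}\right)}.$$ In both cases the maximum and the least equilibrium value exist, and the latter is positive. -/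

import Mathlib

open MeasureTheory ProbabilityTheory

universe u

noncomputable section

/-! ### The energy queue of one transmitter -/

/-- One-step transition probabilities of the energy queue with battery capacity `B`, energy arrival
probability `p` and access probability `q`, on the states `0, 1, …, B`. A transmitter with no energy
cannot transmit, and a unit of energy that arrives at a full battery that is not used is lost. -/
def queueStep (B : ℕ) (p q : ℝ) (i j : Fin (B + 1)) : ℝ :=
  if (i : ℕ) = 0 then
    if (j : ℕ) = 1 then p else if (j : ℕ) = 0 then 1 - p else 0
  else if (j : ℕ) = i + 1 then p * (1 - q)
  else if (j : ℕ) + 1 = i then q * (1 - p)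
  else if j = i then
    if (i : ℕ) = B then 1 - q * (1 - p) else 1 - p * (1 - q) - q * (1 - p)
  else 0

/-- `π` is a stationary distribution of the energy queue. -/
def IsStationaryLaw (B : ℕ) (p q : ℝ) (π : Measure (Fin (B + 1))) : Prop :=
  IsProbabilityMeasure π ∧ ∀ j, π.real {j} = ∑ i, π.real {i} * queueStep B p q i j

open Classical in
/-- `r_B`: the stationary probability that the battery is not empty. (A stationary distribution
exists for all `p, q ∈ [0, 1]`, `1 ≤ B`; for `0 < p` this value does not depend on which one is
chosen.) -/
def availProb (B : ℕ) (p q : ℝ) : ℝ :=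
  if h : ∃ π : Measure (Fin (B + 1)), IsStationaryLaw B p q π then h.choose.real {0}ᶜ else 0

/-- `f_B(q) = q r_B`, the probability that a transmitter with access probability `q` transmits. -/
def activeProb (B : ℕ) (p q : ℝ) : ℝ := q * availProb B p q

/-! ### The network as seen by a typical receiver -/

/-- The plane. -/
abbrev Plane : Type := EuclideanSpace ℝ (Fin 2)

/-- The number of points of the random sequence `X` in the set `A`. -/
def pointCount {Ω : Type*} (X : ℕ → Ω → Plane) (A : Set Plane) (ω : Ω) : ℕ∞ :=
  Set.encard {s | X s ω ∈ A}

/-- The points `X 0, X 1, …` form a homogeneous Poisson point process of density `lam` on the plane: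
counts are Poisson distributed, and counts in disjoint sets are independent. -/
structure IsPoissonProcess {Ω : Type*} [MeasurableSpace Ω] (μ : Measure Ω) (lam : ℝ)
    (X : ℕ → Ω → Plane) : Prop where
  measurable : ∀ s, Measurable (X s)
  count_law : ∀ A : Set Plane, MeasurableSet A → volume A ≠ ⊤ →
    μ.map (pointCount X A) =
      (poissonMeasure (lam * (volume A).toReal).toNNReal).map (Nat.cast : ℕ → ℕ∞)
  count_indep : ∀ (n : ℕ) (A : Fin n → Set Plane), (∀ i, MeasurableSet (A i)) →
    (∀ i, volume (A i) ≠ ⊤) → Pairwise (fun i j => Disjoint (A i) (A j)) →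
    iIndepFun (fun i => pointCount X (A i)) μ

/-- The law of a coin that shows `true` with probability `q`. -/
def coinLaw (q : ℝ) : Measure Bool :=
  ENNReal.ofReal q • Measure.dirac true + ENNReal.ofReal (1 - q) • Measure.dirac false

/-- One time slot, in steady state, of the network in which all interfering transmitters use the
access probability `q`, as seen by the receiver of a typical pair, which is placed at the origin.
By the usual convention for a typical pair, the other transmitters form a homogeneous Poisson
process of density `lam`. The power gains `|h|²` under Rayleigh fading are exponential, with a
common parameter `ν`. -/
structure Network (B : ℕ) (p q lam ν : ℝ) where
  /-- the sample space -/
  Ω : Type u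
  [mΩ : MeasurableSpace Ω]
  /-- the probability -/
  μ : Measure Ω
  [prob : IsProbabilityMeasure μ]
  /-- location of interfering transmitter `s` -/
  pos : ℕ → Ω → Plane
  /-- energy in the battery of interfering transmitter `s` -/
  energy : ℕ → Ω → Fin (B + 1)
  /-- whether interfering transmitter `s` wants to transmit -/
  coin : ℕ → Ω → Bool
  /-- power gain from interfering transmitter `s` to the typical receiver -/
  gain : ℕ → Ω → ℝ
  /-- power gain from the typical transmitter to its receiver -/
  ownGain : Ω → ℝ
  /-- the stationary law of the batteries -/
  energyLaw : Measure (Fin (B + 1))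
  stationary : IsStationaryLaw B p q energyLaw
  poisson : IsPoissonProcess μ lam pos
  measurable_energy : ∀ s, Measurable (energy s)
  measurable_coin : ∀ s, Measurable (coin s)
  measurable_gain : ∀ s, Measurable (gain s)
  measurable_ownGain : Measurable ownGain
  marks_law : ∀ s, μ.map (fun ω => (energy s ω, coin s ω, gain s ω)) =
    energyLaw.prod ((coinLaw q).prod (expMeasure ν))
  marks_indep : iIndepFun (fun s ω => (energy s ω, coin s ω, gain s ω)) μ
  ownGain_law : μ.map ownGain = expMeasure ν
  pos_indep_marks : IndepFun (fun ω s => pos s ω)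
    (fun ω s => (energy s ω, coin s ω, gain s ω)) μ
  ownGain_indep : IndepFun ownGain
    (fun ω => ((fun s => pos s ω), fun s => (energy s ω, coin s ω, gain s ω))) μ

namespace Network

variable {B : ℕ} {p q lam ν : ℝ}

/-- Interfering transmitter `s` transmits: it has energy and it wants to transmit. -/
def Transmits (N : Network.{u} B p q lam ν) (s : ℕ) (ω : N.Ω) : Prop :=
  N.energy s ω ≠ 0 ∧ N.coin s ω = true

open Classical in
/-- The interference at the typical receiver, with path-loss exponent `α`. -/
def interference (N : Network.{u} B p q lam ν) (α : ℝ) (ω : N.Ω) : ENNReal :=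
  ∑' s, if N.Transmits s ω then ‖N.pos s ω‖ₑ ^ (-α) * ENNReal.ofReal (N.gain s ω) else 0

/-- The signal to interference ratio of the typical pair, whose nodes are at distance `d`
(infinite if there is no interference). -/
def SIR (N : Network.{u} B p q lam ν) (α d : ℝ) (ω : N.Ω) : ENNReal :=
  ENNReal.ofReal (d ^ (-α) * N.ownGain ω) / N.interference α ω

/-- The success probability `P(SIR > θ)`. -/
def successProb (N : Network.{u} B p q lam ν) (α d θ : ℝ) : ℝ :=
  haveI := N.mΩ
  N.μ.real {ω | ENNReal.ofReal θ < N.SIR α d ω}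

end Network

/-! ### The throughput game -/

/-- Access probabilities. -/
abbrev Access : Type := Set.Icc (0 : ℝ) 1

/-- The throughput `TH(q, q')` of a transmitter that uses the access probability `q` while all the
others use `q'`; the rate is `log (1 + θ)` bits. -/
def throughput {B : ℕ} {p lam ν : ℝ} (net : ∀ q : Access, Network.{u} B p q lam ν)
    (α d θ : ℝ) (q q' : Access) : ℝ :=
  activeProb B p q * (net q').successProb α d θ * Real.logb 2 (1 + θ)

/-- The transmission capacity when all transmitters use `q`. -/
def capacity {B : ℕ} {p lam ν : ℝ} (net : ∀ q : Access, Network.{u} B p q lam ν)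
    (α d θ : ℝ) (q : Access) : ℝ :=
  lam * throughput net α d θ q q

/-- Symmetric Nash equilibrium of a symmetric game, where `TH q q'` is the payoff of a player who
plays `q` while all the others play `q'`. -/
def IsSNE {S : Type*} (TH : S → S → ℝ) (q : S) : Prop :=
  ∀ q' : S, TH q' q ≤ TH q q

/-- `ρ` is the price of anarchy: the utility `C` at a global optimum over the utility at a worst
symmetric equilibrium; both are attained, and the latter is positive. -/
def IsPriceOfAnarchy {S : Type*} (TH : S → S → ℝ) (C : S → ℝ) (ρ : ℝ) : Prop :=
  ∃ best worst : ℝ, IsGreatest (Set.range C) best ∧ IsLeast (C '' {q | IsSNE TH q}) worst ∧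
    0 < worst ∧ ρ = best / worst

/-- `κ(α)`. -/
def kappa (α : ℝ) : ℝ := 2 * Real.pi ^ 2 / (α * Real.sin (2 * Real.pi / α))

/-- `λ_max`. -/
def lamMax (α d θ : ℝ) : ℝ := 1 / (d ^ 2 * θ ^ (2 / α) * kappa α)

end

/-! A player's own access probability enters the throughput only through `activeProb`, since the
success probability depends on the others alone and is positive. A best response therefore maximizes
`activeProb`, whatever the others do. Energy balance (`IsStationaryLaw.activeProb_eq`) bounds
`activeProb` by `p`, with equality at `q = 1`. So the symmetric equilibria are exactly the `q` with
`activeProb B p q = p`, and all of them have the same capacity. The success probability is explicit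
(`Network.successProb_eq`). The exponential own gain turns it into a Laplace transform of the
interference at `s = θ * d ^ α`; the Laplace functional of a Poisson process with independent marks
and the integral of `1 / (1 + ‖x‖ ^ α / s)` over the plane evaluate that transform. Hence capacity
is a positive constant times `x * exp (-x / m)`, with `x = lam * activeProb B p q` and `m = lamMax α
d θ`. This function increases up to `x = m` and peaks there. A solution of `activeProb = lamMax /
lam` attains the peak. Since `activeProb` is continuous and runs from `0` to `p`, absence of a
solution forces `lam * p < m`; then `q = 1` is both optimal and an equilibrium. Monotonicity of
`activeProb` is not needed. -/

noncomputable section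

/-! ### Stationary distributions of the energy queue -/

/-- Probability that the queue moves up from state `i`. -/
def upProb (B : ℕ) (p q : ℝ) (i : ℕ) : ℝ :=
  if i = 0 then p else if i = B then 0 else p * (1 - q)

/-- Probability that the queue moves down from state `i`. -/
def downProb (p q : ℝ) (i : ℕ) : ℝ := if i = 0 then 0 else q * (1 - p)

/-- Three separate indicators replace the nested cases, so that a sum over `i` collapses to one term
for each kind of move. -/
lemma queueStep_eq {B : ℕ} (_ : 1 ≤ B) (p q : ℝ) (i j : Fin (B + 1)) :
    queueStep B p q i j =
      (if (i : ℕ) = j then 1 - upProb B p q i - downProb p q i else 0) +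
      (if (i : ℕ) + 1 = j then upProb B p q i else 0) +
      (if (i : ℕ) = j + 1 then downProb p q i else 0) := by
  have hi := i.2
  have hj := j.2
  simp only [queueStep, upProb, downProb, Fin.ext_iff]
  split_ifs <;> first | omega | ring

lemma sum_mul_queueStep {B : ℕ} (hB : 1 ≤ B) (p q : ℝ) (x : ℕ → ℝ) (j : Fin (B + 1)) :
    ∑ i : Fin (B + 1), x i * queueStep B p q i j =
      x j * (1 - upProb B p q j - downProb p q j) +
      (if (j : ℕ) = 0 then 0 else x (j - 1) * upProb B p q (j - 1)) +
      (if (j : ℕ) = B then 0 else x (j + 1) * downProb p q (j + 1)) := by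
  simp_rw [queueStep_eq hB, mul_add, Finset.sum_add_distrib]
  have hj := j.2
  congr 1
  · congr 1
    · rw [Fin.sum_univ_eq_sum_range
        (fun i => x i * if i = (j : ℕ) then 1 - upProb B p q i - downProb p q i else 0) (B + 1)]
      simp only [mul_ite, mul_zero, Finset.sum_ite_eq', Finset.mem_range, hj, if_true]
    · rw [Fin.sum_univ_eq_sum_range
        (fun i => x i * if i + 1 = (j : ℕ) then upProb B p q i else 0) (B + 1)]
      split_ifs with h0
      · apply Finset.sum_eq_zero
        intro i _
        rw [if_neg (by omega), mul_zero]
      · rw [Finset.sum_eq_single ((j : ℕ) - 1)]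
        · rw [if_pos (by omega)]
        · intro i _ hi
          rw [if_neg (by omega), mul_zero]
        · intro h
          simp only [Finset.mem_range] at h
          omega
  · rw [Fin.sum_univ_eq_sum_range
      (fun i => x i * if i = (j : ℕ) + 1 then downProb p q i else 0) (B + 1)]
    split_ifs with h0
    · apply Finset.sum_eq_zero
      intro i hi
      simp only [Finset.mem_range] at hi
      rw [if_neg (by omega), mul_zero]
    · rw [Finset.sum_eq_single ((j : ℕ) + 1)]
      · rw [if_pos rfl]
      · intro i _ hi
        rw [if_neg hi, mul_zero]
      · intro h
        simp only [Finset.mem_range] at h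
        omega

/-- The probability mass function of a measure on `Fin (B + 1)`, extended by `0`. -/
def massFun {B : ℕ} (π : Measure (Fin (B + 1))) (k : ℕ) : ℝ :=
  if h : k < B + 1 then π.real {⟨k, h⟩} else 0

lemma massFun_coe {B : ℕ} (π : Measure (Fin (B + 1))) (i : Fin (B + 1)) :
    massFun π i = π.real {i} := by
  rw [massFun, dif_pos i.2]

lemma massFun_nonneg {B : ℕ} (π : Measure (Fin (B + 1))) (k : ℕ) : 0 ≤ massFun π k := by
  unfold massFun
  split_ifs <;> simp

lemma sum_massFun {B : ℕ} (π : Measure (Fin (B + 1))) [IsProbabilityMeasure π] :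
    ∑ k ∈ Finset.range (B + 1), massFun π k = 1 := by
  rw [← Fin.sum_univ_eq_sum_range (massFun π) (B + 1)]
  simp_rw [massFun_coe]
  rw [sum_measureReal_singleton]
  simp

/-- The flow across each cut of a stationary energy queue vanishes. -/
lemma IsStationaryLaw.cut {B : ℕ} (hB : 1 ≤ B) {p q : ℝ} {π : Measure (Fin (B + 1))}
    (h : IsStationaryLaw B p q π) (k : ℕ) (hk : k < B) :
    massFun π k * upProb B p q k = massFun π (k + 1) * downProb p q (k + 1) := by
  have bal : ∀ j (hj : j < B + 1), massFun π j = massFun π j * (1 - upProb B p q j - downProb p q j) +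
      (if j = 0 then 0 else massFun π (j - 1) * upProb B p q (j - 1)) +
      (if j = B then 0 else massFun π (j + 1) * downProb p q (j + 1)) := by
    intro j hj
    have := h.2 ⟨j, hj⟩
    simp_rw [← massFun_coe] at this
    rwa [sum_mul_queueStep hB] at this
  -- Stationarity at `k + 1` equates the net flows across the cuts below and above that state; state
  -- `0` has no cut below it.
  induction k with
  | zero =>
    have := bal 0 (by omega)
    have hd : downProb p q 0 = 0 := by simp [downProb]
    rw [if_pos rfl, if_neg (by omega), hd] at this
    linarith
  | succ k ih =>
    have := bal (k + 1) (by omega)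
    have ih := ih (by omega)
    rw [if_neg (by omega), if_neg (by omega), Nat.add_sub_cancel] at this
    linarith

/-- Normalizing constant of the stationary law of the energy queue. -/
def queueNorm (B : ℕ) (p q : ℝ) : ℝ :=
  (q * (1 - p)) ^ B +
    ∑ k ∈ Finset.range B, p * (p * (1 - q)) ^ k * (q * (1 - p)) ^ (B - 1 - k)

/-- Iterates the cut equation, in cross-multiplied form so that it survives `q * (1 - p) = 0`. -/
lemma IsStationaryLaw.pow_mul_mass {B : ℕ} (hB : 1 ≤ B) {p q : ℝ} {π : Measure (Fin (B + 1))}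
    (h : IsStationaryLaw B p q π) (k : ℕ) (hk : k < B) :
    (q * (1 - p)) ^ (k + 1) * massFun π (k + 1) = p * (p * (1 - q)) ^ k * massFun π 0 := by
  induction k with
  | zero =>
    have := h.cut hB 0 hk
    simp only [upProb, downProb, if_true, zero_add, one_ne_zero, if_false] at this
    simp only [zero_add, pow_one, pow_zero]
    linarith
  | succ k ih =>
    have ih := ih (by omega)
    have := h.cut hB (k + 1) hk
    simp only [upProb, downProb, if_neg (show k + 1 ≠ 0 by omega), if_neg (show k + 1 ≠ B by omega),
      if_neg (show k + 1 + 1 ≠ 0 by omega)] at this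
    calc _ = (q * (1 - p)) ^ (k + 1) * (massFun π (k + 1 + 1) * (q * (1 - p))) := by ring
      _ = (p * (1 - q)) * ((q * (1 - p)) ^ (k + 1) * massFun π (k + 1)) := by rw [← this]; ring
      _ = _ := by rw [ih]; ring

lemma IsStationaryLaw.mass_zero_mul {B : ℕ} (hB : 1 ≤ B) {p q : ℝ} {π : Measure (Fin (B + 1))}
    (h : IsStationaryLaw B p q π) :
    massFun π 0 * queueNorm B p q = (q * (1 - p)) ^ B := by
  have := h.1
  have hs := sum_massFun π
  rw [Finset.sum_range_succ'] at hs
  calc _ = (∑ k ∈ Finset.range B, (q * (1 - p)) ^ B * massFun π (k + 1))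
        + (q * (1 - p)) ^ B * massFun π 0 := by
        rw [queueNorm, mul_add, Finset.mul_sum, add_comm, mul_comm (massFun π 0)]
        congr 1
        refine Finset.sum_congr rfl fun k hk => ?_
        have hk := Finset.mem_range.1 hk
        have e : (q * (1 - p)) ^ B = (q * (1 - p)) ^ (B - 1 - k) * (q * (1 - p)) ^ (k + 1) := by
          rw [← pow_add]
          congr 1
          omega
        rw [e, mul_assoc _ _ (massFun π (k + 1)), h.pow_mul_mass hB k hk]
        ring
    _ = _ := by rw [← Finset.mul_sum, ← mul_add, hs, mul_one]

/-- At `q = 0` the term `k = B - 1` survives because `0 ^ 0 = 1`. The bound `p < 1` matters: for `p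
= q = 1` and `B ≥ 2` the constant vanishes. -/
lemma queueNorm_pos {B : ℕ} (hB : 1 ≤ B) {p q : ℝ} (hp : 0 < p) (hp1 : p < 1) (hq : 0 ≤ q)
    (hq1 : q ≤ 1) : 0 < queueNorm B p q := by
  have h1 : 0 ≤ 1 - p := by linarith
  have h2 : 0 ≤ 1 - q := by linarith
  unfold queueNorm
  rcases hq.eq_or_lt with rfl | hq
  · have : 0 < ∑ k ∈ Finset.range B, p * (p * (1 - 0)) ^ k * (0 * (1 - p)) ^ (B - 1 - k) := by
      apply Finset.sum_pos' (fun k _ => by positivity)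
      refine ⟨B - 1, Finset.mem_range.2 (by omega), ?_⟩
      simp only [Nat.sub_self, pow_zero, mul_one, sub_zero]
      positivity
    positivity
  · have : 0 < 1 - p := by linarith
    have : 0 ≤ ∑ k ∈ Finset.range B, p * (p * (1 - q)) ^ k * (q * (1 - p)) ^ (B - 1 - k) :=
      Finset.sum_nonneg (fun k _ => by positivity)
    positivity

lemma IsStationaryLaw.mass_zero {B : ℕ} (hB : 1 ≤ B) {p q : ℝ} (hp : 0 < p) (hp1 : p ≤ 1)
    (hq : 0 ≤ q) (hq1 : q ≤ 1) {π : Measure (Fin (B + 1))} (h : IsStationaryLaw B p q π) :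
    massFun π 0 = (q * (1 - p)) ^ B / queueNorm B p q := by
  -- For `p = 1` there are no moves down, so the cut above `0` forces an empty battery to have mass
  -- zero. The closed form agrees even where `queueNorm` vanishes, because its numerator is zero.
  rcases hp1.eq_or_lt with rfl | hp1
  · have := h.cut hB 0 (by omega)
    simp only [upProb, downProb, if_true, zero_add, one_ne_zero, if_false] at this
    rw [sub_self, mul_zero, zero_pow (by omega), zero_div]
    linarith
  · rw [eq_div_iff (queueNorm_pos hB hp hp1 hq hq1).ne', h.mass_zero_mul hB]

lemma IsStationaryLaw.real_compl_zero {B : ℕ} {p q : ℝ} {π : Measure (Fin (B + 1))}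
    (h : IsStationaryLaw B p q π) : π.real {0}ᶜ = 1 - massFun π 0 := by
  have := h.1
  rw [probReal_compl_eq_one_sub (MeasurableSet.singleton _), ← massFun_coe]
  rfl

/-- Weights in detailed balance give a stationary law. -/
lemma exists_isStationaryLaw_of_balance {B : ℕ} (hB : 1 ≤ B) {p q : ℝ} (x : ℕ → ℝ)
    (hx : ∀ k, 0 ≤ x k) (hs : ∑ k ∈ Finset.range (B + 1), x k = 1)
    (hb : ∀ k < B, x k * upProb B p q k = x (k + 1) * downProb p q (k + 1)) :
    ∃ π, IsStationaryLaw B p q π := by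
  let π : Measure (Fin (B + 1)) := ∑ i : Fin (B + 1), ENNReal.ofReal (x i) • Measure.dirac i
  have hπ : ∀ j, π {j} = ENNReal.ofReal (x j) := by
    intro j
    simp only [π, Measure.finsetSum_apply, Measure.smul_apply, smul_eq_mul]
    rw [Finset.sum_eq_single j] <;> simp +contextual
  have hr : ∀ j, π.real {j} = x j := fun j => by
    rw [measureReal_def, hπ, ENNReal.toReal_ofReal (hx _)]
  refine ⟨π, ⟨?_⟩, fun j => ?_⟩
  · have : π Set.univ = ∑ i : Fin (B + 1), ENNReal.ofReal (x i) := by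
      simp [π, Measure.finsetSum_apply]
    rw [this, ← ENNReal.ofReal_sum_of_nonneg (fun i _ => hx _),
      Fin.sum_univ_eq_sum_range x (B + 1), hs, ENNReal.ofReal_one]
  · simp_rw [hr]
    rw [sum_mul_queueStep hB]
    obtain ⟨j, hj⟩ := j
    simp only
    have hup : upProb B p q B = 0 := by simp [upProb]; omega
    have hd : downProb p q 0 = 0 := by simp [downProb]
    rcases j with _ | j
    · have := hb 0 (by omega)
      rw [if_pos rfl, if_neg (by omega), hd]
      linarith
    · have := hb j (by omega)
      rw [if_neg (by omega), Nat.add_sub_cancel]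
      split_ifs with h
      · subst h
        rw [hup]
        linarith
      · have := hb (j + 1) (by omega)
        linarith

lemma exists_isStationaryLaw {B : ℕ} (hB : 1 ≤ B) {p q : ℝ} (hp : 0 < p) (hp1 : p ≤ 1)
    (hq : 0 ≤ q) (hq1 : q ≤ 1) : ∃ π, IsStationaryLaw B p q π := by
  rcases hp1.eq_or_lt with rfl | hp1
  -- For `p = 1` the full battery is absorbing.
  · refine exists_isStationaryLaw_of_balance hB (fun k => if k = B then 1 else 0)
      (fun k => by positivity) (by simp) fun k hk => ?_
    simp [downProb, hk.ne]
  · have hW := queueNorm_pos hB hp hp1 hq hq1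
    have h1 : 0 ≤ 1 - p := by linarith
    have h2 : 0 ≤ 1 - q := by linarith
    -- The ratios forced by `pow_mul_mass`, multiplied by `(q * (1 - p)) ^ B` to clear denominators.
    refine exists_isStationaryLaw_of_balance hB
      (fun k => (if k = 0 then (q * (1 - p)) ^ B else
        p * (p * (1 - q)) ^ (k - 1) * (q * (1 - p)) ^ (B - k)) / queueNorm B p q)
      (fun k => by positivity) ?_ fun k hk => ?_
    · rw [← Finset.sum_div, div_eq_one_iff_eq hW.ne', Finset.sum_range_succ', queueNorm, if_pos rfl,
        add_comm]
      congr 1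
      refine Finset.sum_congr rfl fun k _ => ?_
      rw [if_neg (by omega), Nat.add_sub_cancel, Nat.sub_sub, add_comm 1 k]
    · rw [div_mul_eq_mul_div, div_mul_eq_mul_div]
      congr 1
      rcases k with _ | k
      · simp only [upProb, downProb, if_true, zero_add, one_ne_zero, if_false, Nat.sub_self,
          pow_zero, mul_one]
        obtain ⟨n, rfl⟩ : ∃ n, B = n + 1 := ⟨B - 1, by omega⟩
        simp only [Nat.add_sub_cancel]
        ring
      · obtain ⟨n, rfl⟩ : ∃ n, B = k + 2 + n := ⟨B - (k + 2), by omega⟩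
        simp only [upProb, downProb, if_neg (show k + 1 ≠ 0 by omega),
          if_neg (show k + 1 ≠ k + 2 + n by omega), if_neg (show k + 1 + 1 ≠ 0 by omega),
          show k + 2 + n - (k + 1) = n + 1 by omega, show k + 2 + n - (k + 1 + 1) = n by omega,
          Nat.add_sub_cancel]
        ring

lemma availProb_eq {B : ℕ} (hB : 1 ≤ B) {p q : ℝ} (hp : 0 < p) (hp1 : p ≤ 1)
    (hq : 0 ≤ q) (hq1 : q ≤ 1) :
    availProb B p q = 1 - (q * (1 - p)) ^ B / queueNorm B p q := by
  have h := exists_isStationaryLaw hB hp hp1 hq hq1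
  rw [availProb, dif_pos h, h.choose_spec.real_compl_zero,
    h.choose_spec.mass_zero hB hp hp1 hq hq1]

/-- Every stationary law gives the same probability of a non-empty battery. -/
lemma IsStationaryLaw.availProb_eq {B : ℕ} (hB : 1 ≤ B) {p q : ℝ} (hp : 0 < p) (hp1 : p ≤ 1)
    (hq : 0 ≤ q) (hq1 : q ≤ 1) {π : Measure (Fin (B + 1))} (h : IsStationaryLaw B p q π) :
    availProb B p q = π.real {0}ᶜ := by
  rw [_root_.availProb_eq hB hp hp1 hq hq1, h.real_compl_zero, h.mass_zero hB hp hp1 hq hq1]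

/-- Energy balance: what is used is what arrives and is not lost at a full battery. -/
lemma IsStationaryLaw.activeProb_eq {B : ℕ} (hB : 1 ≤ B) {p q : ℝ} (hp : 0 < p) (hp1 : p ≤ 1)
    (hq : 0 ≤ q) (hq1 : q ≤ 1) {π : Measure (Fin (B + 1))} (h : IsStationaryLaw B p q π) :
    activeProb B p q = p - p * (1 - q) * massFun π B := by
  have := h.1
  rw [activeProb, h.availProb_eq hB hp hp1 hq hq1, h.real_compl_zero]
  have hs := sum_massFun π
  have hs1 := hs
  have hs2 := hs
  rw [Finset.sum_range_succ'] at hs1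
  -- Summing the cut equations equates the mean rates of moves up and down. The empty and full
  -- states are then split off, as their up-rates are exceptional.
  have hsum : ∑ k ∈ Finset.range B, massFun π k * upProb B p q k =
      ∑ k ∈ Finset.range B, massFun π (k + 1) * downProb p q (k + 1) :=
    Finset.sum_congr rfl fun k hk => h.cut hB k (Finset.mem_range.1 hk)
  have hr : ∑ k ∈ Finset.range B, massFun π (k + 1) * downProb p q (k + 1) =
      (1 - massFun π 0) * (q * (1 - p)) := by
    simp only [downProb, if_neg (Nat.succ_ne_zero _)]
    rw [← Finset.sum_mul]
    congr 1
    linarith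
  obtain ⟨n, rfl⟩ : ∃ n, B = n + 1 := ⟨B - 1, by omega⟩
  rw [Finset.sum_range_succ, Finset.sum_range_succ'] at hs2
  have hl : ∑ k ∈ Finset.range (n + 1), massFun π k * upProb (n + 1) p q k =
      (1 - massFun π 0 - massFun π (n + 1)) * (p * (1 - q)) + massFun π 0 * p := by
    rw [Finset.sum_range_succ']
    congr 1
    · rw [show 1 - massFun π 0 - massFun π (n + 1) = ∑ k ∈ Finset.range n, massFun π (k + 1) by
        linarith, Finset.sum_mul]
      refine Finset.sum_congr rfl fun k hk => ?_
      have := Finset.mem_range.1 hk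
      rw [upProb, if_neg (by omega), if_neg (by omega)]
  rw [hl, hr] at hsum
  linarith

lemma activeProb_le {B : ℕ} (hB : 1 ≤ B) {p q : ℝ} (hp : 0 < p) (hp1 : p ≤ 1)
    (hq : 0 ≤ q) (hq1 : q ≤ 1) : activeProb B p q ≤ p := by
  obtain ⟨π, h⟩ := exists_isStationaryLaw hB hp hp1 hq hq1
  rw [h.activeProb_eq hB hp hp1 hq hq1]
  have : 0 ≤ p * (1 - q) * massFun π B :=
    mul_nonneg (mul_nonneg hp.le (by linarith)) (massFun_nonneg _ _)
  linarith

lemma activeProb_one {B : ℕ} (hB : 1 ≤ B) {p : ℝ} (hp : 0 < p) (hp1 : p ≤ 1) :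
    activeProb B p 1 = p := by
  obtain ⟨π, h⟩ := exists_isStationaryLaw (q := 1) hB hp hp1 zero_le_one le_rfl
  rw [h.activeProb_eq hB hp hp1 zero_le_one le_rfl]
  simp

lemma activeProb_zero (B : ℕ) (p : ℝ) : activeProb B p 0 = 0 := by
  simp [activeProb]

lemma activeProb_nonneg {B : ℕ} (hB : 1 ≤ B) {p q : ℝ} (hp : 0 < p) (hp1 : p ≤ 1)
    (hq : 0 ≤ q) (hq1 : q ≤ 1) : 0 ≤ activeProb B p q := by
  obtain ⟨π, h⟩ := exists_isStationaryLaw hB hp hp1 hq hq1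
  rw [activeProb, h.availProb_eq hB hp hp1 hq hq1]
  exact mul_nonneg hq measureReal_nonneg

lemma continuousOn_activeProb {B : ℕ} (hB : 1 ≤ B) {p : ℝ} (hp : 0 < p) (hp1 : p ≤ 1) :
    ContinuousOn (activeProb B p) (Set.Icc 0 1) := by
  have hc : ContinuousOn (fun q : ℝ => q * (1 - (q * (1 - p)) ^ B / queueNorm B p q))
      (Set.Icc 0 1) := by
    -- For `p = 1` the denominator may vanish, but the function is simply `q`.
    rcases hp1.eq_or_lt with rfl | hp1
    · simp only [sub_self, mul_zero, zero_pow (show B ≠ 0 by omega), zero_div, sub_zero, mul_one]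
      exact continuousOn_id
    · have hn : Continuous (queueNorm B p) := by unfold queueNorm; fun_prop
      refine continuousOn_id.mul (continuousOn_const.sub (ContinuousOn.div (by fun_prop)
        hn.continuousOn fun q hq => (queueNorm_pos hB hp hp1 hq.1 hq.2).ne'))
  refine hc.congr fun q hq => ?_
  rw [activeProb, availProb_eq hB hp hp1 hq.1 hq.2]

/-! ### Laplace functional of a Poisson process -/

/-- `exp (-x)` for `x ∈ [0, ∞]`. -/
def negExp (x : ENNReal) : ENNReal := EReal.exp (-(x : EReal))

@[simp] lemma negExp_zero : negExp 0 = 1 := by simp [negExp]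

@[simp] lemma negExp_top : negExp ⊤ = 0 := by simp [negExp]

lemma negExp_ofReal {t : ℝ} (ht : 0 ≤ t) :
    negExp (ENNReal.ofReal t) = ENNReal.ofReal (Real.exp (-t)) := by
  rw [negExp, EReal.coe_ennreal_ofReal, max_eq_left ht, ← EReal.coe_neg, EReal.exp_coe]

lemma negExp_add (x y : ENNReal) : negExp (x + y) = negExp x * negExp y := by
  rw [negExp, negExp, negExp, ← EReal.exp_add, EReal.coe_ennreal_add, EReal.neg_add, sub_eq_add_neg]
  · exact Or.inl (EReal.coe_ennreal_ne_bot _)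
  · exact Or.inr (EReal.coe_ennreal_ne_bot _)

lemma negExp_sum {ι : Type*} (s : Finset ι) (f : ι → ENNReal) :
    negExp (∑ i ∈ s, f i) = ∏ i ∈ s, negExp (f i) := by
  classical
  induction s using Finset.induction_on with
  | empty => simp
  | insert a s ha ih => rw [Finset.sum_insert ha, Finset.prod_insert ha, negExp_add, ih]

lemma negExp_natCast_mul (n : ℕ) (x : ENNReal) : negExp (n * x) = negExp x ^ n := by
  have := negExp_sum (Finset.range n) (fun _ => x)
  simpa using this

lemma continuous_negExp : Continuous negExp :=
  ENNReal.continuous_exp.comp (continuous_neg.comp continuous_coe_ennreal_ereal)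

@[fun_prop]
lemma measurable_negExp : Measurable negExp := continuous_negExp.measurable

lemma antitone_negExp : Antitone negExp := fun x y h =>
  EReal.exp_monotone (EReal.neg_le_neg_iff.2 (by exact_mod_cast h))

lemma negExp_le_one (x : ENNReal) : negExp x ≤ 1 := by
  simpa using antitone_negExp (zero_le (a := x))

/-- Lets an average over marks be rewritten as an unmarked function to which the Laplace functional
applies. The exponent `⊤` covers the value `0`. -/
lemma exists_negExp_eq {α : Type*} [MeasurableSpace α] {M : α → ENNReal} (hM : Measurable M)
    (h1 : ∀ x, M x ≤ 1) : ∃ φ : α → ENNReal, Measurable φ ∧ ∀ x, negExp (φ x) = M x := by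
  refine ⟨fun x => (-(ENNReal.log (M x))).toENNReal, ?_, fun x => ?_⟩
  · exact (hM.ennreal_log.neg).ereal_toENNReal
  · rw [negExp, EReal.coe_toENNReal, neg_neg, ENNReal.exp_log]
    rw [EReal.neg_nonneg]
    exact ENNReal.log_le_zero_iff.2 (h1 x)

/-- The probability generating function of a Poisson law. -/
lemma lintegral_pow_poissonMeasure (r : NNReal) {z : ENNReal} (hz : z ≤ 1) :
    ∫⁻ n, z ^ n ∂poissonMeasure r = negExp (r * (1 - z)) := by
  lift z to NNReal using ne_top_of_le_ne_top ENNReal.one_ne_top hz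
  have hz' : (z : ℝ) ≤ 1 := by exact_mod_cast hz
  have h0 : 0 ≤ (r : ℝ) * (1 - z) := mul_nonneg r.2 (by linarith)
  have e1 : (r : ENNReal) * (1 - z) = ENNReal.ofReal (r * (1 - z)) := by
    rw [ENNReal.ofReal_mul r.coe_nonneg, ENNReal.ofReal_sub _ z.coe_nonneg, ENNReal.ofReal_one,
      ENNReal.ofReal_coe_nnreal, ENNReal.ofReal_coe_nnreal]
  rw [e1, negExp_ofReal h0, lintegral_countable']
  have e2 : ∀ n : ℕ, (z : ENNReal) ^ n * poissonMeasure r {n} =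
      ENNReal.ofReal (Real.exp (-r) * ((r * z : ℝ) ^ n / n.factorial)) := by
    intro n
    rw [poissonMeasure_singleton, ← ENNReal.ofReal_coe_nnreal, ← ENNReal.ofReal_pow z.coe_nonneg,
      ← ENNReal.ofReal_mul (by positivity)]
    congr 1
    ring
  simp_rw [e2]
  have hs := (NormedSpace.expSeries_div_hasSum_exp ((r : ℝ) * z)).mul_left (Real.exp (-r))
  rw [← Real.exp_eq_exp_ℝ] at hs
  rw [← ENNReal.ofReal_tsum_of_nonneg (fun n => by positivity) hs.summable, hs.tsum_eq,
    ← Real.exp_add]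
  congr 2
  ring

lemma measurable_natCast_enat : Measurable (Nat.cast : ℕ → ℕ∞) := measurable_from_top

section Laplace

variable {Ω : Type*} [MeasurableSpace Ω] {μ : Measure Ω} {lam : ℝ} {X : ℕ → Ω → Plane}

lemma measurable_pointCount (hX : ∀ s, Measurable (X s)) {A : Set Plane}
    (hA : MeasurableSet A) : Measurable (pointCount X A) := by
  have hm : Measurable fun ω => ∑' s, A.indicator (fun _ => (1 : ENNReal)) (X s ω) :=
    Measurable.tsum fun s => (measurable_const.indicator hA).comp (hX s)
  have he : ∀ ω, ∑' s, A.indicator (fun _ => (1 : ENNReal)) (X s ω) =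
      (pointCount X A ω : ENNReal) := by
    intro ω
    have : ∀ s, A.indicator (fun _ => (1 : ENNReal)) (X s ω) =
        {s | X s ω ∈ A}.indicator (fun _ => 1) s := fun s => rfl
    simp_rw [this]
    rw [← tsum_subtype, ENNReal.tsum_set_const, mul_one]
    rfl
  simp_rw [he] at hm
  refine measurable_to_countable' fun n => ?_
  convert hm (measurableSet_singleton (n : ENNReal)) using 1
  ext ω
  simp

lemma measurable_enat_toENNReal : Measurable (fun n : ℕ∞ => (n : ENNReal)) :=
  Measurable.of_discrete

/-- The Poisson generating function evaluated at `negExp c`. -/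
lemma IsPoissonProcess.laplace_count [IsProbabilityMeasure μ]
    (h : IsPoissonProcess μ lam X) (hlam : 0 ≤ lam) {A : Set Plane}
    (hA : MeasurableSet A) (hv : volume A ≠ ⊤) (c : ENNReal) :
    ∫⁻ ω, negExp (c * (pointCount X A ω : ℕ∞)) ∂μ =
      negExp (ENNReal.ofReal lam * (volume A * (1 - negExp c))) := by
  have hm : Measurable (fun n : ℕ∞ => negExp (c * (n : ENNReal))) :=
    measurable_negExp.comp (measurable_enat_toENNReal.const_mul c)
  rw [← lintegral_map' (f := fun n : ℕ∞ => negExp (c * (n : ENNReal))) hm.aemeasurable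
    (measurable_pointCount h.measurable hA).aemeasurable, h.count_law A hA hv,
    lintegral_map hm measurable_natCast_enat]
  simp_rw [ENat.toENNReal_coe, mul_comm c, negExp_natCast_mul]
  rw [lintegral_pow_poissonMeasure _ (negExp_le_one c), ← mul_assoc]
  congr 2
  rw [show (((lam * (volume A).toReal).toNNReal : NNReal) : ENNReal) =
    ENNReal.ofReal (lam * (volume A).toReal) from rfl, ENNReal.ofReal_mul hlam,
    ENNReal.ofReal_toReal hv]

/-- The sum over points is a combination of counts in the level sets of the nonzero values. These
sets are disjoint and of finite volume, so the counts are independent Poisson variables and the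
transform factorizes. -/
lemma IsPoissonProcess.laplace_simple [IsProbabilityMeasure μ]
    (h : IsPoissonProcess μ lam X) (hlam : 0 ≤ lam) (f : SimpleFunc Plane ENNReal)
    (hf : f.FinMeasSupp volume) :
    ∫⁻ ω, negExp (∑' s, f (X s ω)) ∂μ =
      negExp (ENNReal.ofReal lam * ∫⁻ x, (1 - negExp (f x))) := by
  classical
  let R := f.range.filter (· ≠ 0)
  let e := R.equivFin.symm
  let c : Fin R.card → ENNReal := fun k => (e k : ENNReal)
  let A : Fin R.card → Set Plane := fun k => f ⁻¹' {c k}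
  have hA : ∀ k, MeasurableSet (A k) := fun k => f.measurableSet_fiber _
  have hc0 : ∀ k, c k ≠ 0 := fun k => (Finset.mem_filter.1 (e k).2).2
  have hv : ∀ k, volume (A k) ≠ ⊤ := fun k =>
    ((SimpleFunc.finMeasSupp_iff.1 hf) (c k) (hc0 k)).ne
  have hd : Pairwise (fun i j => Disjoint (A i) (A j)) := by
    intro i j hij
    refine Set.disjoint_left.2 fun x hx hx' => hij ?_
    have : c i = c j := hx.symm.trans hx'
    exact e.injective (Subtype.ext this)
  -- Used for `F = id` in the sum over points and for `F = 1 - negExp` in the exponent; `F 0 = 0`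
  -- makes the omitted level set harmless.
  have dec : ∀ (F : ENNReal → ENNReal), F 0 = 0 → ∀ x,
      F (f x) = ∑ k, (A k).indicator (fun _ => F (c k)) x := by
    intro F hF x
    by_cases hx : f x = 0
    · rw [hx, hF, Finset.sum_eq_zero]
      intro k _
      rw [Set.indicator_of_notMem]
      intro hk
      exact hc0 k (hk.symm.trans hx)
    · have hxR : f x ∈ R := Finset.mem_filter.2 ⟨f.mem_range_self x, hx⟩
      have hcx : c (e.symm ⟨f x, hxR⟩) = f x := by simp [c]
      rw [Finset.sum_eq_single (e.symm ⟨f x, hxR⟩)]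
      · rw [Set.indicator_of_mem, hcx]
        exact hcx.symm
      · intro k _ hk
        rw [Set.indicator_of_notMem]
        intro hk'
        apply hk
        rw [Equiv.eq_symm_apply]
        exact Subtype.ext (Eq.symm hk')
      · simp
  have hsum : ∀ ω, ∑' s, f (X s ω) = ∑ k, c k * (pointCount X (A k) ω : ℕ∞) := by
    intro ω
    have hd' : ∀ x, f x = ∑ k, (A k).indicator (fun _ => c k) x := dec id rfl
    simp_rw [hd']
    rw [Summable.tsum_finsetSum (fun _ _ => ENNReal.summable)]
    refine Finset.sum_congr rfl fun k _ => ?_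
    have : ∀ s, (A k).indicator (fun _ => c k) (X s ω) =
        {s | X s ω ∈ A k}.indicator (fun _ => c k) s := fun s => rfl
    simp_rw [this]
    rw [← tsum_subtype, ENNReal.tsum_set_const, mul_comm]
    rfl
  simp_rw [hsum, negExp_sum]
  have hind := h.count_indep _ A hA hv hd
  have hm : ∀ k, Measurable (fun n : ℕ∞ => negExp (c k * (n : ENNReal))) := fun k =>
    measurable_negExp.comp (measurable_enat_toENNReal.const_mul (c k))
  have hind' := hind.comp _ hm
  have := lintegral_prod_eq_prod_lintegral_of_indepFun Finset.univ _ hind'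
    (fun k => (hm k).comp (measurable_pointCount h.measurable (hA k)))
  simp only [Function.comp_apply] at this
  rw [this]
  simp_rw [h.laplace_count hlam (hA _) (hv _), ← negExp_sum, ← Finset.mul_sum]
  congr 2
  simp_rw [dec (fun y => 1 - negExp y) (by simp)]
  rw [lintegral_finsetSum _ (fun k _ => measurable_const.indicator (hA k))]
  refine Finset.sum_congr rfl fun k _ => ?_
  rw [lintegral_indicator_const (hA k), mul_comm]

/-- The Laplace functional of a Poisson process. -/
theorem IsPoissonProcess.laplace [IsProbabilityMeasure μ]
    (h : IsPoissonProcess μ lam X) (hlam : 0 ≤ lam) {φ : Plane → ENNReal} (hφ : Measurable φ) :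
    ∫⁻ ω, negExp (∑' s, φ (X s ω)) ∂μ =
      negExp (ENNReal.ofReal lam * ∫⁻ x, (1 - negExp (φ x))) := by
  -- Truncation to balls gives support of finite measure while the approximations still increase to
  -- `φ`.
  let f : ℕ → SimpleFunc Plane ENNReal := fun n =>
    (SimpleFunc.eapprox φ n).restrict (Metric.ball 0 n)
  have hfa : ∀ n x, f n x = (Metric.ball 0 n).indicator (SimpleFunc.eapprox φ n) x := fun n x =>
    SimpleFunc.restrict_apply _ measurableSet_ball x
  have hmono : ∀ x, Monotone (fun n => f n x) := by
    intro x m n hmn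
    simp only [hfa]
    refine (Set.indicator_le_indicator (SimpleFunc.monotone_eapprox φ hmn x)).trans
      (Set.indicator_le_indicator_of_subset (Metric.ball_subset_ball (by exact_mod_cast hmn))
        (fun _ => zero_le) x)
  have hsup : ∀ x, Filter.Tendsto (fun n => f n x) Filter.atTop (nhds (φ x)) := by
    intro x
    refine (SimpleFunc.tendsto_eapprox hφ x).congr' ?_
    obtain ⟨N, hN⟩ := exists_nat_gt ‖x‖
    filter_upwards [Filter.eventually_ge_atTop N] with n hn
    rw [hfa, Set.indicator_of_mem]
    rw [mem_ball_zero_iff]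
    exact hN.trans_le (by exact_mod_cast hn)
  have hfin : ∀ n, (f n).FinMeasSupp volume := by
    intro n
    refine SimpleFunc.finMeasSupp_iff.2 fun y hy => ?_
    refine (measure_mono fun x hx => ?_).trans_lt (measure_ball_lt_top (x := (0 : Plane)) (r := n))
    by_contra hxb
    apply hy
    rw [← (show f n x = y from hx), hfa, Set.indicator_of_notMem hxb]
  have key := fun n => h.laplace_simple hlam (f n) (hfin n)
  have hmt : ∀ n, Measurable fun ω => ∑' s, f n (X s ω) := fun n =>
    Measurable.tsum fun s => (f n).measurable.comp (h.measurable s)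
  have hL : Filter.Tendsto (fun n => ∫⁻ ω, negExp (∑' s, f n (X s ω)) ∂μ) Filter.atTop
      (nhds (∫⁻ ω, negExp (∑' s, φ (X s ω)) ∂μ)) := by
    refine tendsto_lintegral_of_dominated_convergence (fun _ => 1)
      (fun n => measurable_negExp.comp (hmt n)) (fun n => ae_of_all _ fun ω => negExp_le_one _)
      (by simp) (ae_of_all _ fun ω => ?_)
    refine (continuous_negExp.tendsto _).comp ?_
    have := lintegral_tendsto_of_tendsto_of_monotone (μ := Measure.count)
      (f := fun n s => f n (X s ω)) (F := fun s => φ (X s ω)) (fun n => by fun_prop)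
      (ae_of_all _ fun s => hmono _) (ae_of_all _ fun s => hsup _)
    simpa [lintegral_count] using this
  have hR : Filter.Tendsto (fun n => negExp (ENNReal.ofReal lam * ∫⁻ x, (1 - negExp (f n x))))
      Filter.atTop (nhds (negExp (ENNReal.ofReal lam * ∫⁻ x, (1 - negExp (φ x))))) := by
    refine (continuous_negExp.tendsto _).comp (ENNReal.Tendsto.const_mul ?_
      (Or.inr ENNReal.ofReal_ne_top))
    refine lintegral_tendsto_of_tendsto_of_monotone
      (fun n => ((measurable_negExp.comp (f n).measurable).const_sub 1).aemeasurable)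
      (ae_of_all _ fun x m n hmn => tsub_le_tsub_left (antitone_negExp (hmono x hmn)) 1)
      (ae_of_all _ fun x => ?_)
    exact ENNReal.Tendsto.sub tendsto_const_nhds ((continuous_negExp.tendsto _).comp (hsup x))
      (Or.inl ENNReal.one_ne_top)
  refine tendsto_nhds_unique hL ?_
  simp_rw [key]
  exact hR

end Laplace

/-- Averaging over independent marks. -/
lemma lintegral_negExp_tsum_marks {Ω E F : Type*} [MeasurableSpace Ω] [MeasurableSpace E]
    [MeasurableSpace F] {μ : Measure Ω} [IsProbabilityMeasure μ] {X : ℕ → Ω → E} {Y : ℕ → Ω → F}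
    {ρ : Measure F} (hX : ∀ s, Measurable (X s)) (hY : ∀ s, Measurable (Y s))
    (hXY : IndepFun (fun ω s => X s ω) (fun ω s => Y s ω) μ) (hind : iIndepFun Y μ)
    (hρ : ∀ s, μ.map (Y s) = ρ) {g : E × F → ENNReal} (hg : Measurable g) {φ : E → ENNReal}
    (hφ : Measurable φ) (hφg : ∀ x, negExp (φ x) = ∫⁻ y, negExp (g (x, y)) ∂ρ) :
    ∫⁻ ω, negExp (∑' s, g (X s ω, Y s ω)) ∂μ = ∫⁻ ω, negExp (∑' s, φ (X s ω)) ∂μ := by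
  have hXm : Measurable (fun ω s => X s ω) := measurable_pi_lambda _ hX
  have hYm : Measurable (fun ω s => Y s ω) := measurable_pi_lambda _ hY
  -- For finitely many points, independence freezes the positions, and the integral over the marks
  -- is a product; dominated convergence then passes to the series.
  have key : ∀ n, ∫⁻ ω, negExp (∑ s ∈ Finset.range n, g (X s ω, Y s ω)) ∂μ =
      ∫⁻ ω, negExp (∑ s ∈ Finset.range n, φ (X s ω)) ∂μ := by
    intro n
    have hG : Measurable (fun z : (ℕ → E) × (ℕ → F) =>
        negExp (∑ s ∈ Finset.range n, g (z.1 s, z.2 s))) := by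
      refine measurable_negExp.comp (Finset.measurable_sum _ fun s _ => hg.comp ?_)
      fun_prop
    have e1 : ∫⁻ ω, negExp (∑ s ∈ Finset.range n, g (X s ω, Y s ω)) ∂μ =
        ∫⁻ z, negExp (∑ s ∈ Finset.range n, g (z.1 s, z.2 s))
          ∂(μ.map (fun ω => ((fun s => X s ω), fun s => Y s ω))) :=
      (lintegral_map hG (hXm.prodMk hYm)).symm
    have : IsProbabilityMeasure (μ.map fun ω s => X s ω) :=
      Measure.isProbabilityMeasure_map hXm.aemeasurable
    have : IsProbabilityMeasure (μ.map fun ω s => Y s ω) :=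
      Measure.isProbabilityMeasure_map hYm.aemeasurable
    rw [e1, hXY.map_prod_eq_prod_map_map hXm.aemeasurable hYm.aemeasurable,
      lintegral_prod _ hG.aemeasurable]
    have e2 : ∀ x : ℕ → E, ∫⁻ y, negExp (∑ s ∈ Finset.range n, g (x s, y s))
        ∂(μ.map fun ω s => Y s ω) = negExp (∑ s ∈ Finset.range n, φ (x s)) := by
      intro x
      have hmg : ∀ s, Measurable fun y => negExp (g (x s, y)) := fun s =>
        measurable_negExp.comp (hg.comp measurable_prodMk_left)
      rw [lintegral_map (f := fun y : ℕ → F => negExp (∑ s ∈ Finset.range n, g (x s, y s)))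
        (hG.comp measurable_prodMk_left) hYm]
      simp_rw [negExp_sum]
      have := lintegral_prod_eq_prod_lintegral_of_indepFun (Finset.range n) _ (hind.comp _ hmg)
        (fun s => (hmg s).comp (hY s))
      simp only [Function.comp_apply] at this
      rw [this]
      refine Finset.prod_congr rfl fun s _ => ?_
      rw [hφg, ← hρ s, lintegral_map (hmg s) (hY s)]
    simp_rw [e2]
    rw [lintegral_map _ hXm]
    exact measurable_negExp.comp (Finset.measurable_sum _ fun s _ => hφ.comp (measurable_pi_apply s))
  have lim : ∀ u : ℕ → Ω → ENNReal, (∀ s, Measurable (u s)) →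
      Filter.Tendsto (fun n => ∫⁻ ω, negExp (∑ s ∈ Finset.range n, u s ω) ∂μ) Filter.atTop
        (nhds (∫⁻ ω, negExp (∑' s, u s ω) ∂μ)) := by
    intro u hu
    refine tendsto_lintegral_of_dominated_convergence (fun _ => 1)
      (fun n => measurable_negExp.comp (Finset.measurable_fun_sum _ fun s _ => hu s))
      (fun n => ae_of_all _ fun ω => negExp_le_one _) (by simp) (ae_of_all _ fun ω => ?_)
    exact (continuous_negExp.tendsto _).comp ENNReal.summable.hasSum.tendsto_sum_nat
  refine tendsto_nhds_unique (lim (fun s ω => g (X s ω, Y s ω))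
    fun s => hg.comp ((hX s).prodMk (hY s))) ?_
  simp_rw [key]
  exact lim (fun s ω => φ (X s ω)) fun s => hφ.comp (hX s)

/-! ### Exponential fading and the interference integral -/

lemma measurable_exponentialPDF (r : ℝ) : Measurable (exponentialPDF r) :=
  (measurable_exponentialPDFReal r).ennreal_ofReal

lemma lintegral_expMeasure (r : ℝ) {f : ℝ → ENNReal} (hf : Measurable f) :
    ∫⁻ g, f g ∂expMeasure r = ∫⁻ g, exponentialPDF r g * f g :=
  lintegral_withDensity_eq_lintegral_mul _ (measurable_exponentialPDF r) hf

/-- The Laplace transform of an exponential law. -/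
lemma lintegral_negExp_expMeasure {ν t : ℝ} (hν : 0 < ν) (ht : 0 ≤ t) :
    ∫⁻ g, negExp (ENNReal.ofReal (ν * t) * ENNReal.ofReal g) ∂expMeasure ν =
      ENNReal.ofReal (1 / (1 + t)) := by
  rw [lintegral_expMeasure _ (by fun_prop)]
  -- Tilting an exponential density gives a multiple of the exponential density of rate `ν * (1 +
  -- t)`, which has total mass one.
  have e : ∀ g : ℝ, exponentialPDF ν g * negExp (ENNReal.ofReal (ν * t) * ENNReal.ofReal g) =
      ENNReal.ofReal (1 / (1 + t)) * exponentialPDF (ν * (1 + t)) g := by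
    intro g
    rcases lt_or_ge g 0 with hg | hg
    · rw [exponentialPDF_of_neg hg, exponentialPDF_of_neg hg, zero_mul, mul_zero]
    · rw [exponentialPDF_of_nonneg hg, exponentialPDF_of_nonneg hg,
        ← ENNReal.ofReal_mul (by positivity), negExp_ofReal (by positivity),
        ← ENNReal.ofReal_mul (by positivity), ← ENNReal.ofReal_mul (by positivity), mul_assoc,
        ← Real.exp_add, show 1 / (1 + t) * (ν * (1 + t) * Real.exp (-(ν * (1 + t) * g))) =
          ν * Real.exp (-(ν * (1 + t) * g)) by field_simp]
      congr 3
      ring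
  simp_rw [e]
  rw [lintegral_const_mul _ (measurable_exponentialPDF _),
    lintegral_exponentialPDF_eq_one (by positivity), mul_one]

/-- The tail of an exponential law. -/
lemma expMeasure_lt_ofReal {ν a : ℝ} (hν : 0 < ν) (ha : 0 < a) (y : ENNReal) :
    expMeasure ν {h | y < ENNReal.ofReal (a * h)} = negExp (ENNReal.ofReal (ν / a) * y) := by
  have := isProbabilityMeasure_expMeasure hν
  by_cases hy : y = ⊤
  · subst hy
    rw [ENNReal.mul_top (by simpa using div_pos hν ha)]
    simp
  · lift y to NNReal using hy
    have hset : {h : ℝ | (y : ENNReal) < ENNReal.ofReal (a * h)} = (Set.Iic ((y : ℝ) / a))ᶜ := by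
      ext h
      simp only [Set.mem_ofPred_eq, Set.mem_compl_iff, Set.mem_Iic, not_le]
      rw [← ENNReal.ofReal_coe_nnreal, ENNReal.ofReal_lt_ofReal_iff_of_nonneg y.coe_nonneg,
        div_lt_iff₀' ha]
    have hy0 : 0 ≤ (y : ℝ) / a := div_nonneg y.coe_nonneg ha.le
    rw [hset, ← ofReal_measureReal, probReal_compl_eq_one_sub measurableSet_Iic, ← cdf_eq_real,
      cdf_expMeasure_eq hν, if_pos hy0, sub_sub_cancel, ← ENNReal.ofReal_coe_nnreal,
      ← ENNReal.ofReal_mul (by positivity), negExp_ofReal (by positivity)]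
    congr 3
    ring

lemma lintegral_rpow_neg_expMeasure {b : ℝ} (hb : b < 1) :
    ∫⁻ g, ENNReal.ofReal (g ^ (-b)) ∂expMeasure 1 = ENNReal.ofReal (Real.Gamma (1 - b)) := by
  have hG : 0 < Real.Gamma (1 - b) := Real.Gamma_pos_of_pos (by linarith)
  rw [lintegral_expMeasure _ (by fun_prop)]
  have e : ∀ᵐ g : ℝ, exponentialPDF 1 g * ENNReal.ofReal (g ^ (-b)) =
      ENNReal.ofReal (Real.Gamma (1 - b)) * gammaPDF (1 - b) 1 g := by
    have h0 : ∀ᵐ g : ℝ, g ≠ 0 := by simp [ae_iff]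
    filter_upwards [h0] with g hg0
    rcases lt_or_gt_of_ne hg0 with hg | hg
    · rw [exponentialPDF_of_neg hg, gammaPDF_of_neg hg, zero_mul, mul_zero]
    · rw [exponentialPDF_of_nonneg hg.le, gammaPDF_of_nonneg hg.le,
        ← ENNReal.ofReal_mul (by positivity), ← ENNReal.ofReal_mul hG.le, Real.one_rpow,
        show 1 - b - 1 = -b by ring]
      congr 1
      field_simp
  rw [lintegral_congr_ae e, lintegral_const_mul (f := gammaPDF (1 - b) 1) _
    (measurable_gammaPDFReal _ _).ennreal_ofReal,
    lintegral_gammaPDF_eq_one (by linarith) one_pos, mul_one]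

lemma lintegral_plane_exp_neg_mul_rpow {α b : ℝ} (hα : 1 ≤ α) (hb : 0 < b) :
    ∫⁻ x : Plane, ENNReal.ofReal (Real.exp (-(b * ‖x‖ ^ α))) =
      ENNReal.ofReal (Real.pi * b ^ (-2 / α) * Real.Gamma (2 / α + 1)) := by
  have h := Complex.orthonormalBasisOneI.measurePreserving_repr
  have hm : Measurable fun x : Plane => ENNReal.ofReal (Real.exp (-(b * ‖x‖ ^ α))) := by fun_prop
  rw [← h.lintegral_comp hm]
  simp_rw [LinearIsometryEquiv.norm_map]
  have hI := Complex.integral_exp_neg_mul_rpow hα hb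
  simp_rw [neg_mul] at hI
  rw [← hI, ofReal_integral_eq_lintegral_ofReal _ (ae_of_all _ fun x => (Real.exp_pos _).le)]
  -- A non-integrable function has integral `0` by convention, so the nonzero value proves
  -- integrability.
  refine Integrable.of_integral_ne_zero ?_
  rw [hI]
  have : 0 < Real.Gamma (2 / α + 1) := Real.Gamma_pos_of_pos (by positivity)
  positivity

/-- The integrand is the Laplace transform of a unit exponential variable `g` at `‖x‖ ^ α / s`.
Swapping integrals leaves the moment of order `-2 / α` of `g`, finite since `α > 2`, and Euler's
reflection formula produces the sine in `kappa`. -/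
lemma lintegral_plane_one_div_one_add {α s : ℝ} (hα : 2 < α) (hs : 0 < s) :
    ∫⁻ x : Plane, ENNReal.ofReal (1 / (1 + ‖x‖ ^ α / s)) =
      ENNReal.ofReal (s ^ (2 / α) * kappa α) := by
  have h2 : 2 / α < 1 := (div_lt_one (by linarith)).2 hα
  have h20 : 0 < 2 / α := by positivity
  have e1 : ∀ x : Plane, ENNReal.ofReal (1 / (1 + ‖x‖ ^ α / s)) =
      ∫⁻ g, negExp (ENNReal.ofReal (‖x‖ ^ α / s) * ENNReal.ofReal g) ∂expMeasure 1 := by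
    intro x
    rw [← lintegral_negExp_expMeasure one_pos (by positivity), one_mul]
  have := isProbabilityMeasure_expMeasure one_pos
  simp_rw [e1]
  rw [lintegral_lintegral_swap (Measurable.aemeasurable (by unfold Function.uncurry; fun_prop))]
  have e2 : ∀ᵐ g ∂expMeasure 1,
      ∫⁻ x : Plane, negExp (ENNReal.ofReal (‖x‖ ^ α / s) * ENNReal.ofReal g) =
      ENNReal.ofReal (Real.pi * s ^ (2 / α) * Real.Gamma (2 / α + 1)) *
        ENNReal.ofReal (g ^ (-(2 / α))) := by
    have h0 : ∀ᵐ g ∂expMeasure 1, 0 < g := by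
      have : expMeasure 1 {h | 0 < ENNReal.ofReal (1 * h)} = 1 := by
        rw [expMeasure_lt_ofReal one_pos one_pos]
        simp
      rw [← mem_ae_iff_prob_eq_one (measurableSet_lt measurable_const (by fun_prop))] at this
      filter_upwards [this] with g hg
      simpa using hg
    filter_upwards [h0] with g hg
    have e3 : ∀ x : Plane, negExp (ENNReal.ofReal (‖x‖ ^ α / s) * ENNReal.ofReal g) =
        ENNReal.ofReal (Real.exp (-(g / s * ‖x‖ ^ α))) := by
      intro x
      rw [← ENNReal.ofReal_mul (by positivity), negExp_ofReal (by positivity)]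
      congr 3
      ring
    simp_rw [e3]
    have hG : 0 < Real.Gamma (2 / α + 1) := Real.Gamma_pos_of_pos (by positivity)
    rw [lintegral_plane_exp_neg_mul_rpow (by linarith) (by positivity),
      ← ENNReal.ofReal_mul (by positivity), neg_div, Real.rpow_neg (by positivity),
      Real.div_rpow hg.le hs.le, Real.rpow_neg hg.le]
    congr 1
    field_simp
  have hG : 0 < Real.Gamma (2 / α + 1) := Real.Gamma_pos_of_pos (by positivity)
  rw [lintegral_congr_ae e2, lintegral_const_mul _ (by fun_prop), lintegral_rpow_neg_expMeasure h2,
    ← ENNReal.ofReal_mul (by positivity), Real.Gamma_add_one h20.ne', kappa]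
  congr 1
  have := Real.Gamma_mul_Gamma_one_sub (2 / α)
  calc _ = Real.pi * s ^ (2 / α) * (2 / α) * (Real.Gamma (2 / α) * Real.Gamma (1 - 2 / α)) := by
        ring
    _ = _ := by
      rw [this, show Real.pi * (2 / α) = 2 * Real.pi / α by ring]
      field_simp

lemma kappa_pos {α : ℝ} (hα : 2 < α) : 0 < kappa α := by
  have : 0 < Real.sin (2 * Real.pi / α) := by
    apply Real.sin_pos_of_pos_of_lt_pi
    · have := Real.pi_pos
      positivity
    · rw [div_lt_iff₀ (by linarith)]
      nlinarith [Real.pi_pos]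
  have := Real.pi_pos
  unfold kappa
  positivity

lemma lamMax_pos {α d θ : ℝ} (hα : 2 < α) (hd : 0 < d) (hθ : 0 < θ) : 0 < lamMax α d θ := by
  have := kappa_pos hα
  unfold lamMax
  positivity

/-! ### The success probability -/

lemma coinLaw_isProbabilityMeasure {q : ℝ} (hq : 0 ≤ q) (hq1 : q ≤ 1) :
    IsProbabilityMeasure (coinLaw q) := by
  constructor
  simp only [coinLaw, Measure.add_apply, Measure.smul_apply, measure_univ, smul_eq_mul, mul_one]
  rw [← ENNReal.ofReal_add hq (by linarith)]
  simp

open Classical in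
/-- The contribution, scaled by `c`, of a transmitter at `z.1` with marks `z.2` (battery, coin and
gain) to the interference at the origin. -/
def powerAt (B : ℕ) (α c : ℝ) (z : Plane × Fin (B + 1) × Bool × ℝ) : ENNReal :=
  ENNReal.ofReal c * if z.2.1 ≠ 0 ∧ z.2.2.1 = true then
    ‖z.1‖ₑ ^ (-α) * ENNReal.ofReal z.2.2.2 else 0

lemma measurable_powerAt (B : ℕ) (α c : ℝ) : Measurable (powerAt B α c) := by
  unfold powerAt
  refine Measurable.const_mul (Measurable.ite ?_ (by fun_prop) measurable_const) _
  have : Measurable fun z : Plane × Fin (B + 1) × Bool × ℝ => (z.2.1, z.2.2.1) := by fun_prop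
  exact this (MeasurableSet.of_discrete (s := {w : Fin (B + 1) × Bool | w.1 ≠ 0 ∧ w.2 = true}))

/-- The mean loss caused by one transmitter at `x ≠ 0`. -/
lemma one_sub_lintegral_negExp_powerAt {B : ℕ} {q ν α s : ℝ} (hq : 0 ≤ q) (hq1 : q ≤ 1)
    (hν : 0 < ν) (hs : 0 < s) (π : Measure (Fin (B + 1))) [IsProbabilityMeasure π] {x : Plane}
    (hx : x ≠ 0) :
    1 - ∫⁻ y, negExp (powerAt B α (ν * s) (x, y)) ∂(π.prod ((coinLaw q).prod (expMeasure ν))) =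
      ENNReal.ofReal (q * π.real {0}ᶜ) * ENNReal.ofReal (1 / (1 + ‖x‖ ^ α / s)) := by
  have := isProbabilityMeasure_expMeasure hν
  have := coinLaw_isProbabilityMeasure hq hq1
  have hxn : 0 < ‖x‖ := norm_pos_iff.2 hx
  have hm : Measurable fun y => negExp (powerAt B α (ν * s) (x, y)) :=
    measurable_negExp.comp ((measurable_powerAt B α _).comp measurable_prodMk_left)
  let w : ℝ → ENNReal := fun g =>
    1 - negExp (ENNReal.ofReal (ν * (s * ‖x‖ ^ (-α))) * ENNReal.ofReal g)
  have hw : Measurable w :=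
    by fun_prop
  -- Only a transmitter with energy and a `true` coin causes loss, so the loss is a product of
  -- functions of the single marks.
  have e1 : ∀ y : Fin (B + 1) × Bool × ℝ, 1 - negExp (powerAt B α (ν * s) (x, y)) =
      ({0}ᶜ : Set (Fin (B + 1))).indicator 1 y.1 *
        (({true} : Set Bool).indicator 1 y.2.1 * w y.2.2) := by
    rintro ⟨e, c, g⟩
    simp only [powerAt]
    by_cases he : e = 0
    · simp [he]
    · cases c
      · simp
      · simp only [he, ne_eq, not_false_eq_true, and_self, if_true, Set.mem_compl_iff,
          Set.mem_singleton_iff, Set.indicator_of_mem, Pi.one_apply, one_mul, w]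
        rw [← ofReal_norm, ENNReal.ofReal_rpow_of_pos hxn, ← mul_assoc,
          ← ENNReal.ofReal_mul (by positivity), mul_assoc ν]
  have e2 : 1 - ∫⁻ y, negExp (powerAt B α (ν * s) (x, y))
        ∂(π.prod ((coinLaw q).prod (expMeasure ν))) =
      ∫⁻ y, (1 - negExp (powerAt B α (ν * s) (x, y)))
        ∂(π.prod ((coinLaw q).prod (expMeasure ν))) := by
    rw [lintegral_sub hm _ (ae_of_all _ fun _ => negExp_le_one _)]
    · simp
    · refine ne_top_of_le_ne_top ENNReal.one_ne_top
        ((lintegral_mono fun _ => negExp_le_one _).trans ?_)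
      simp
  have e3 : ∫⁻ g, w g ∂expMeasure ν = ENNReal.ofReal (1 / (1 + ‖x‖ ^ α / s)) := by
    have h0 : 0 ≤ s * ‖x‖ ^ (-α) := by positivity
    have hl := lintegral_negExp_expMeasure hν h0
    rw [lintegral_sub (by fun_prop) _
      (ae_of_all _ fun _ => negExp_le_one _), hl]
    · rw [lintegral_one, measure_univ, ← ENNReal.ofReal_one,
        ← ENNReal.ofReal_sub _ (by positivity), Real.rpow_neg hxn.le]
      congr 1
      have : 0 < ‖x‖ ^ α := by positivity
      field_simp
      ring
    · rw [hl]
      exact ENNReal.ofReal_ne_top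
  have e4 : coinLaw q {true} = ENNReal.ofReal q := by simp [coinLaw]
  rw [e2]
  simp_rw [e1]
  rw [lintegral_prod_mul
      (f := ({0}ᶜ : Set (Fin (B + 1))).indicator 1)
      (g := fun y : Bool × ℝ => ({true} : Set Bool).indicator 1 y.1 * w y.2)
      (Measurable.of_discrete).aemeasurable
      (((Measurable.of_discrete (f := ({true} : Set Bool).indicator 1)).comp measurable_fst).mul
        (hw.comp measurable_snd)).aemeasurable,
    lintegral_prod_mul (f := ({true} : Set Bool).indicator 1) (g := w)
      (Measurable.of_discrete).aemeasurable hw.aemeasurable,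
    lintegral_indicator_one (MeasurableSet.of_discrete),
    lintegral_indicator_one (MeasurableSet.of_discrete), e3, e4, ENNReal.ofReal_mul hq,
    ofReal_measureReal, ← mul_assoc, mul_comm (ENNReal.ofReal q)]

namespace Network

variable {B : ℕ} {p q lam ν : ℝ}

attribute [local instance] Network.mΩ Network.prob

/-- The marks of an interfering transmitter: battery, coin and gain. -/
def mark (N : Network.{u} B p q lam ν) (s : ℕ) (ω : N.Ω) : Fin (B + 1) × Bool × ℝ :=
  (N.energy s ω, N.coin s ω, N.gain s ω)

lemma measurable_mark (N : Network.{u} B p q lam ν) (s : ℕ) : Measurable (N.mark s) :=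
  (N.measurable_energy s).prodMk ((N.measurable_coin s).prodMk (N.measurable_gain s))

lemma ofReal_mul_interference (N : Network.{u} B p q lam ν) (α c : ℝ) (ω : N.Ω) :
    ENNReal.ofReal c * N.interference α ω = ∑' s, powerAt B α c (N.pos s ω, N.mark s ω) := by
  rw [interference, ← ENNReal.tsum_mul_left]
  refine tsum_congr fun s => ?_
  simp only [powerAt, mark, Transmits]
  congr

lemma interference_eq (N : Network.{u} B p q lam ν) (α : ℝ) (ω : N.Ω) :
    N.interference α ω = ∑' s, powerAt B α 1 (N.pos s ω, N.mark s ω) := by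
  rw [← ofReal_mul_interference, ENNReal.ofReal_one, one_mul]

/-- The Laplace transform of the interference. -/
lemma lintegral_negExp_interference (N : Network.{u} B p q lam ν) (hB : 1 ≤ B) (hp : 0 < p)
    (hp1 : p ≤ 1) (hq : 0 ≤ q) (hq1 : q ≤ 1) (hlam : 0 < lam) (hν : 0 < ν) {α s : ℝ}
    (hα : 2 < α) (hs : 0 < s) :
    ∫⁻ ω, negExp (ENNReal.ofReal (ν * s) * N.interference α ω) ∂N.μ =
      ENNReal.ofReal (Real.exp (-(lam * (activeProb B p q * (s ^ (2 / α) * kappa α))))) := by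
  have := N.stationary.1
  have := isProbabilityMeasure_expMeasure hν
  have := coinLaw_isProbabilityMeasure hq hq1
  have hκ := kappa_pos hα
  have hf := activeProb_nonneg hB hp hp1 hq hq1
  simp_rw [ofReal_mul_interference]
  let ρ := N.energyLaw.prod ((coinLaw q).prod (expMeasure ν))
  have hM : Measurable fun x : Plane => ∫⁻ y, negExp (powerAt B α (ν * s) (x, y)) ∂ρ :=
    Measurable.lintegral_prod_right' (measurable_negExp.comp (measurable_powerAt B α (ν * s)))
  obtain ⟨φ, hφ, hφM⟩ := exists_negExp_eq hM fun x =>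
    (lintegral_mono fun _ => negExp_le_one _).trans (by simp [ρ])
  rw [lintegral_negExp_tsum_marks N.poisson.measurable N.measurable_mark N.pos_indep_marks
    N.marks_indep N.marks_law (measurable_powerAt B α (ν * s)) hφ hφM,
    N.poisson.laplace hlam.le hφ]
  have hae : ∀ᵐ x : Plane, 1 - negExp (φ x) =
      ENNReal.ofReal (activeProb B p q) * ENNReal.ofReal (1 / (1 + ‖x‖ ^ α / s)) := by
    have h0 : ∀ᵐ x : Plane, x ≠ 0 := by simp [ae_iff]
    filter_upwards [h0] with x hx
    rw [hφM, one_sub_lintegral_negExp_powerAt hq hq1 hν hs _ hx, activeProb,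
      N.stationary.availProb_eq hB hp hp1 hq hq1]
  rw [lintegral_congr_ae hae, lintegral_const_mul _ (by fun_prop),
    lintegral_plane_one_div_one_add hα hs, ← ENNReal.ofReal_mul hf, ← ENNReal.ofReal_mul hlam.le,
    negExp_ofReal (by positivity)]

/-- The degenerate quotients agree with the cleared form: with zero signal or infinite interference
both sides are false. -/
lemma lt_SIR_iff (N : Network.{u} B p q lam ν) (α d : ℝ) {θ : ℝ} (hθ : 0 < θ) (ω : N.Ω) :
    ENNReal.ofReal θ < N.SIR α d ω ↔
      ENNReal.ofReal θ * N.interference α ω < ENNReal.ofReal (d ^ (-α) * N.ownGain ω) := by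
  rw [SIR]
  by_cases h : ENNReal.ofReal (d ^ (-α) * N.ownGain ω) = 0
  · simp [h]
  · by_cases hI : N.interference α ω = ⊤
    · simp [hI, ENNReal.mul_top, hθ, ENNReal.div_top]
    · exact ENNReal.lt_div_iff_mul_lt (Or.inr ENNReal.ofReal_ne_top) (Or.inl hI)

/-- The success probability of a typical pair. -/
theorem successProb_eq (N : Network.{u} B p q lam ν) (hB : 1 ≤ B) (hp : 0 < p)
    (hp1 : p ≤ 1) (hq : 0 ≤ q) (hq1 : q ≤ 1) (hlam : 0 < lam) (hν : 0 < ν) {α d θ : ℝ}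
    (hα : 2 < α) (hd : 0 < d) (hθ : 0 < θ) :
    N.successProb α d θ = Real.exp (-(activeProb B p q * lam / lamMax α d θ)) := by
  let G : (ℕ → Plane) × (ℕ → Fin (B + 1) × Bool × ℝ) → ENNReal := fun z =>
    ∑' s, powerAt B α 1 (z.1 s, z.2 s)
  have hG : Measurable G := Measurable.tsum fun s =>
    (measurable_powerAt B α 1).comp (by fun_prop)
  have hI : Measurable fun ω => N.interference α ω := by
    simp_rw [interference_eq]
    exact Measurable.tsum fun s => (measurable_powerAt B α 1).comp
      ((N.poisson.measurable s).prodMk (N.measurable_mark s))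
  have hind : IndepFun N.ownGain (fun ω => N.interference α ω) N.μ := by
    have := N.ownGain_indep.comp measurable_id hG
    simp_rw [interference_eq]
    exact this
  have hda : 0 < d ^ (-α) := Real.rpow_pos_of_pos hd _
  let S : Set (ENNReal × ℝ) := {z | ENNReal.ofReal θ * z.1 < ENNReal.ofReal (d ^ (-α) * z.2)}
  have hS : MeasurableSet S := measurableSet_lt (by fun_prop) (by fun_prop)
  have := isProbabilityMeasure_expMeasure hν
  have hIp : IsProbabilityMeasure (N.μ.map fun ω => N.interference α ω) :=
    Measure.isProbabilityMeasure_map hI.aemeasurable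
  have hc : ∀ y : ENNReal, ENNReal.ofReal (ν / d ^ (-α)) * (ENNReal.ofReal θ * y) =
      ENNReal.ofReal (ν * (θ * d ^ α)) * y := by
    intro y
    rw [← mul_assoc, ← ENNReal.ofReal_mul (by positivity), Real.rpow_neg hd.le, div_inv_eq_mul,
      mul_assoc, mul_comm θ]
  have key : N.μ {ω | ENNReal.ofReal θ < N.SIR α d ω} =
      ENNReal.ofReal (Real.exp (-(lam * (activeProb B p q *
        ((θ * d ^ α) ^ (2 / α) * kappa α))))) := by
    rw [← lintegral_negExp_interference N hB hp hp1 hq hq1 hlam hν hα (s := θ * d ^ α)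
      (by positivity)]
    have hset : {ω | ENNReal.ofReal θ < N.SIR α d ω} =
        (fun ω => (N.interference α ω, N.ownGain ω)) ⁻¹' S := by
      ext ω
      exact lt_SIR_iff N α d hθ ω
    rw [hset, ← Measure.map_apply (hI.prodMk N.measurable_ownGain) hS,
      hind.symm.map_prod_eq_prod_map_map hI.aemeasurable N.measurable_ownGain.aemeasurable,
      N.ownGain_law, Measure.prod_apply hS]
    -- Given interference `y`, success is an exponential tail event.
    have hsec : ∀ y : ENNReal, expMeasure ν (Prod.mk y ⁻¹' S) =
        negExp (ENNReal.ofReal (ν * (θ * d ^ α)) * y) := by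
      intro y
      rw [← hc, ← expMeasure_lt_ofReal hν hda]
      rfl
    simp_rw [hsec]
    rw [lintegral_map (by fun_prop) hI]
  rw [successProb, measureReal_def, key, ENNReal.toReal_ofReal (Real.exp_pos _).le]
  congr 2
  have e : (θ * d ^ α) ^ (2 / α) = d ^ 2 * θ ^ (2 / α) := by
    rw [Real.mul_rpow hθ.le (by positivity), ← Real.rpow_mul hd.le,
      mul_div_cancel₀ _ (by linarith : α ≠ 0), Real.rpow_two, mul_comm]
  rw [e, lamMax]
  field_simp

end Network

/-! ### Equilibria and the price of anarchy -/

/-- `x exp (-x / m)` is increasing up to `m`, ... -/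
lemma mul_exp_neg_div_le {m x y : ℝ} (hxy : x ≤ y) (hy : 0 < y) (hym : y ≤ m) :
    x * Real.exp (-(x / m)) ≤ y * Real.exp (-(y / m)) := by
  have h1 : (y - x) / m ≤ (y - x) / y :=
    div_le_div_of_nonneg_left (by linarith) hy hym
  -- From `1 + u ≤ exp u` at `u = -((y - x) / m)`, together with `y ≤ m`.
  have h2 : x / y ≤ Real.exp (-((y - x) / m)) := by
    have := Real.add_one_le_exp (-((y - x) / m))
    have h3 : x / y = 1 - (y - x) / y := by field_simp; ring
    linarith
  rw [div_le_iff₀ hy] at h2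
  calc x * Real.exp (-(x / m)) ≤ Real.exp (-((y - x) / m)) * y * Real.exp (-(x / m)) :=
        mul_le_mul_of_nonneg_right h2 (Real.exp_pos _).le
    _ = y * (Real.exp (-((y - x) / m)) * Real.exp (-(x / m))) := by ring
    _ = _ := by
      rw [← Real.exp_add]
      congr 2
      ring

/-- ... where it has its maximum. -/
lemma mul_exp_neg_div_le_max {m : ℝ} (hm : 0 < m) (x : ℝ) :
    x * Real.exp (-(x / m)) ≤ m * Real.exp (-(m / m)) := by
  have h2 : x / m ≤ Real.exp (x / m - 1) := by
    have := Real.add_one_le_exp (x / m - 1)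
    linarith
  rw [div_le_iff₀ hm] at h2
  calc x * Real.exp (-(x / m)) ≤ Real.exp (x / m - 1) * m * Real.exp (-(x / m)) :=
        mul_le_mul_of_nonneg_right h2 (Real.exp_pos _).le
    _ = m * (Real.exp (x / m - 1) * Real.exp (-(x / m))) := by ring
    _ = _ := by
      rw [← Real.exp_add, div_self hm.ne']
      congr 2
      ring

/-- Every best response to a positive success probability transmits as often as energy arrives, so
that the worst symmetric equilibrium has the capacity of the access probability `1`. -/
lemma isPriceOfAnarchy_of_isMax {B : ℕ} (hB : 1 ≤ B) {p lam ν α d θ : ℝ} (hp : 0 < p) (hp1 : p ≤ 1)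
    (hlam : 0 < lam) (hν : 0 < ν) (hα : 2 < α) (hd : 0 < d) (hθ : 0 < θ)
    (net : ∀ q : Access, Network.{u} B p q lam ν) {qs : Access}
    (hqs : ∀ q, capacity net α d θ q ≤ capacity net α d θ qs) :
    IsPriceOfAnarchy (throughput net α d θ) (capacity net α d θ)
      (lam * activeProb B p qs * Real.exp (-(activeProb B p qs * lam / lamMax α d θ)) /
        (lam * p * Real.exp (-(p * lam / lamMax α d θ)))) := by
  have hR : 0 < Real.logb 2 (1 + θ) := Real.logb_pos one_lt_two (by linarith)
  have hsuc : ∀ q : Access, (net q).successProb α d θ =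
      Real.exp (-(activeProb B p q * lam / lamMax α d θ)) := fun q =>
    (net q).successProb_eq hB hp hp1 q.2.1 q.2.2 hlam hν hα hd hθ
  have hC : ∀ q : Access, capacity net α d θ q =
      lam * activeProb B p q * Real.exp (-(activeProb B p q * lam / lamMax α d θ)) *
        Real.logb 2 (1 + θ) := by
    intro q
    rw [capacity, throughput, hsuc]
    ring
  -- The factor contributed by the others is positive and cancels, so preferences do not depend on
  -- `q''`.
  have hTH : ∀ q q' q'' : Access, throughput net α d θ q q'' ≤ throughput net α d θ q' q'' ↔
      activeProb B p q ≤ activeProb B p q' := by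
    intro q q' q''
    rw [throughput, throughput, hsuc, mul_le_mul_iff_left₀ hR,
      mul_le_mul_iff_left₀ (Real.exp_pos _)]
  let one : Access := ⟨1, zero_le_one, le_rfl⟩
  have hone : activeProb B p one = p := activeProb_one hB hp hp1
  have hSNE : ∀ q, IsSNE (throughput net α d θ) q ↔ activeProb B p q = p := by
    intro q
    refine ⟨fun h => le_antisymm (activeProb_le hB hp hp1 q.2.1 q.2.2) ?_, fun h q' => ?_⟩
    · have := (hTH _ _ _).1 (h one)
      rwa [hone] at this
    · rw [hTH, h]
      exact activeProb_le hB hp hp1 q'.2.1 q'.2.2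
  refine ⟨_, lam * p * Real.exp (-(p * lam / lamMax α d θ)) * Real.logb 2 (1 + θ),
    ⟨⟨qs, rfl⟩, ?_⟩, ⟨⟨one, (hSNE one).2 hone, ?_⟩, ?_⟩, by positivity, ?_⟩
  · rintro _ ⟨q, rfl⟩
    exact hqs q
  · rw [hC, hone]
  · rintro _ ⟨q, hq, rfl⟩
    rw [hC, (hSNE q).1 hq]
  · rw [hC, mul_div_mul_right _ _ hR.ne']

end

theorem lemma3 {B : ℕ} (hB : 1 ≤ B) {p lam ν α d θ : ℝ} (hp : 0 < p) (hp1 : p ≤ 1)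
    (hlam : 0 < lam) (hν : 0 < ν) (hα : 2 < α) (hd : 0 < d) (hθ : 0 < θ)
    (net : ∀ q : Access, Network.{u} B p q lam ν) :
    ((∀ y ∈ Set.Icc (0 : ℝ) 1, activeProb B p y ≠ lamMax α d θ / lam) →
      IsPriceOfAnarchy (throughput net α d θ) (capacity net α d θ) 1) ∧
    (∀ qs : Access, activeProb B p qs = lamMax α d θ / lam →
      (∀ q, capacity net α d θ q ≤ capacity net α d θ qs) ∧
      IsPriceOfAnarchy (throughput net α d θ) (capacity net α d θ)
        (lam * activeProb B p qs * Real.exp (-(activeProb B p qs * lam / lamMax α d θ)) /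
          (lam * p * Real.exp (-(p * lam / lamMax α d θ))))) := by
  have hm := lamMax_pos hα hd hθ
  have hR : 0 < Real.logb 2 (1 + θ) := Real.logb_pos one_lt_two (by linarith)
  have hC : ∀ q : Access, capacity net α d θ q =
      activeProb B p q * lam * Real.exp (-(activeProb B p q * lam / lamMax α d θ)) *
        Real.logb 2 (1 + θ) := by
    intro q
    rw [capacity, throughput, (net q).successProb_eq hB hp hp1 q.2.1 q.2.2 hlam hν hα hd hθ]
    ring
  constructor
  · intro hno
    -- Otherwise `lamMax / lam` lies between the values `0` and `p` of `activeProb` at the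
    -- endpoints, and the intermediate value theorem gives a solution.
    have hlt : p * lam < lamMax α d θ := by
      by_contra! hle
      obtain ⟨y, hy, hfy⟩ := intermediate_value_Icc zero_le_one (continuousOn_activeProb hB hp hp1)
        (show lamMax α d θ / lam ∈ Set.Icc (activeProb B p 0) (activeProb B p 1) by
          rw [activeProb_zero, activeProb_one hB hp hp1]
          exact ⟨by positivity, (div_le_iff₀ hlam).2 hle⟩)
      exact hno y hy hfy
    have hone := activeProb_one hB hp hp1
    have key := isPriceOfAnarchy_of_isMax hB hp hp1 hlam hν hα hd hθ net
      (qs := ⟨1, zero_le_one, le_rfl⟩) fun q => by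
        rw [hC, hC]
        simp only [hone]
        exact mul_le_mul_of_nonneg_right (mul_exp_neg_div_le
          (mul_le_mul_of_nonneg_right (activeProb_le hB hp hp1 q.2.1 q.2.2) hlam.le)
          (by positivity) hlt.le) hR.le
    simp only [hone] at key
    rwa [div_self (by positivity)] at key
  · intro qs hqs
    have hmax : ∀ q, capacity net α d θ q ≤ capacity net α d θ qs := by
      intro q
      -- At `qs` the load `lam * activeProb` equals `lamMax`, the peak of `x * exp (-x / m)`.
      rw [hC, hC, hqs, div_mul_cancel₀ _ hlam.ne']
      exact mul_le_mul_of_nonneg_right (mul_exp_neg_div_le_max hm _) hR.le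
    exact ⟨hmax, isPriceOfAnarchy_of_isMax hB hp hp1 hlam hν hα hd hθ net hmax⟩
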